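/- Let $A\in\mathbb{R}^{n\times n}$ be a real symmetric positive definite matrix with smallest and largest eigenvalues $\lambda_{\min}$ and $\lambda_{\max}$, and let $\kappa=\lambda_{\max}/\lambda_{\min}$ be its condition number. For a nonzero $v\in\mathbb{R}^n$ and an integer $m\ge 0$, the $m$-step Lanczos iteration sets $v_1=v/\|v\|_2$, $\beta_0v_0=0$ and, for $k=1,2,\dots$, $\alpha_k=v_k^TAv_k$, $\tilde v_{k+1}=Av_k-\alpha_kv_k-\beta_{k-1}v_{k-1}$, $\beta_k=\|\tilde v_{k+1}\|_2$, $v_{k+1}=\tilde v_{k+1}/\beta_k$. It produces the symmetric tridiagonal matrix $T$ with diagonal $\alpha_1,\dots,\alpha_{d+1}$ and off-diagonal $\beta_1,\dots,\beta_d$, where $d=m$, unless some $\beta_k$ with $k\le m$ vanishes; then the iteration stops and $d+1$ is the first such $k$. Let $\theta_k$ be the eigenvalues of $T$, with an orthonormal basis of eigenvectors $y_k$, put $\tau_k=(e_1^Ty_k)^2$ and $I_m(v)=\sum_{k=1}^{d+1}\tau_k\log\theta_k$. Let $z^{(1)},\dots,z^{(N)}\in\mathbb{R}^n$ be random vectors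 whose $nN$ entries are independent and equal to $+1$ or $-1$ with probability $1/2$ each. The stochastic Lanczos quadrature estimate of $\log\det A$ with $m$ Lanczos steps and $N$ queries is $$[\log\det A]_L=\frac nN\sum_{i=1}^N I_m\!\left(z^{(i)}/\sqrt n\right).$$ Let $\epsilon,\eta\in(0,1)$. If $$m\ge\frac{1}{2\log\rho_1}\log\left(\frac{K_{\rho_1}}{\epsilon}\right)\quad\text{and}\quad N\ge\frac{24}{\epsilon^2}\,(\log(1+\kappa))^2\,\log\frac2\eta,$$ where $$\rho_1=\frac{\sqrt{2\kappa+1}+1}{\sqrt{2\kappa+1}-1},\qquad K_{\rho_1}=\frac{8M_{\rho_1}}{\rho_1^2-\rho_1},\qquad M_{\rho_1}=5\log(2(\kappa+1)),$$ then $$\mathbb{P}\Big\{\big|\log\det A-[\log\det A]_L\big|\le\epsilon n\Big\}\ge 1-\eta.$$ No symmetry of the quadrature nodes is assumed. -/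

import Mathlib

open MeasureTheory ProbabilityTheory
open scoped RealInnerProductSpace

noncomputable section

namespace SLQ

/-- State of the Lanczos three-term recurrence: the previous vector `v_{k-1}`, the coefficient
`β_{k-1}`, and the current vector `v_k`. -/
structure LanczosState (n : ℕ) where
  prev : EuclideanSpace ℝ (Fin n)
  beta : ℝ
  cur : EuclideanSpace ℝ (Fin n)

/-- The diagonal coefficient `α_k = v_kᵀ A v_k`. -/
def LanczosState.alpha {n : ℕ} (A : Matrix (Fin n) (Fin n) ℝ) (s : LanczosState n) : ℝ :=
  ⟪s.cur, A.toEuclideanLin s.cur⟫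

/-- The unnormalized next vector `A v_k - α_k v_k - β_{k-1} v_{k-1}`. -/
def LanczosState.residual {n : ℕ} (A : Matrix (Fin n) (Fin n) ℝ) (s : LanczosState n) :
    EuclideanSpace ℝ (Fin n) :=
  A.toEuclideanLin s.cur - s.alpha A • s.cur - s.beta • s.prev

/-- The states of the Lanczos iteration started at `v / ‖v‖`. Indices are zero-based: state `k`
holds the vector that is called `v_{k+1}` in one-based numbering. In the first state `prev` and
`beta` are zero, so that the first residual is `A v₁ - α₁ v₁`. -/
def lanczos {n : ℕ} (A : Matrix (Fin n) (Fin n) ℝ) (v : EuclideanSpace ℝ (Fin n)) :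
    ℕ → LanczosState n
  | 0 => ⟨0, 0, ‖v‖⁻¹ • v⟩
  | k + 1 =>
    let s := lanczos A v k
    ⟨s.cur, ‖s.residual A‖, ‖s.residual A‖⁻¹ • s.residual A⟩

/-- `diagCoeff A v k` is `α_{k+1}` in one-based numbering. -/
def diagCoeff {n : ℕ} (A : Matrix (Fin n) (Fin n) ℝ) (v : EuclideanSpace ℝ (Fin n)) (k : ℕ) : ℝ :=
  (lanczos A v k).alpha A

/-- `offCoeff A v k` is `β_{k+1}` in one-based numbering, the norm of the residual of state `k`. -/
def offCoeff {n : ℕ} (A : Matrix (Fin n) (Fin n) ℝ) (v : EuclideanSpace ℝ (Fin n)) (k : ℕ) : ℝ :=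
  ‖(lanczos A v k).residual A‖

/-- The number of steps that the `m`-step Lanczos iteration actually performs: `m`, or fewer if
a coefficient `β` vanishes earlier. In that case the next vector `0 / 0` does not exist, the Krylov
space is `A`-invariant, and the iteration stops with the Jacobi matrix built so far. -/
def stepCount {n : ℕ} (A : Matrix (Fin n) (Fin n) ℝ) (v : EuclideanSpace ℝ (Fin n)) (m : ℕ) : ℕ :=
  sInf {k : ℕ | k = m ∨ offCoeff A v k = 0}

/-- The symmetric tridiagonal `(d+1) × (d+1)` matrix with diagonal `α₁, …, α_{d+1}` and
off-diagonals `β₁, …, β_d`. -/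
def jacobiMatrix {n : ℕ} (A : Matrix (Fin n) (Fin n) ℝ) (v : EuclideanSpace ℝ (Fin n)) (d : ℕ) :
    Matrix (Fin (d + 1)) (Fin (d + 1)) ℝ :=
  Matrix.of fun i j =>
    if i = j then diagCoeff A v i
    else if (i : ℕ) + 1 = j then offCoeff A v i
    else if (j : ℕ) + 1 = i then offCoeff A v j
    else 0

theorem jacobiMatrix_isHermitian {n : ℕ} (A : Matrix (Fin n) (Fin n) ℝ)
    (v : EuclideanSpace ℝ (Fin n)) (d : ℕ) : (jacobiMatrix A v d).IsHermitian := by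
  ext i j
  simp only [jacobiMatrix, Matrix.conjTranspose_apply, Matrix.of_apply, star_trivial]
  by_cases h : i = j
  · subst h; simp
  · rw [if_neg h, if_neg (Ne.symm h)]
    split_ifs <;> first | rfl | omega

/-- The quadrature nodes: eigenvalues of the Jacobi matrix (Ritz values). -/
def node {n : ℕ} (A : Matrix (Fin n) (Fin n) ℝ) (v : EuclideanSpace ℝ (Fin n)) (m : ℕ)
    (k : Fin (stepCount A v m + 1)) : ℝ :=
  (jacobiMatrix_isHermitian A v (stepCount A v m)).eigenvalues k

/-- The quadrature weights: squared first entries of the normalized eigenvectors of the Jacobi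
matrix. -/
def weight {n : ℕ} (A : Matrix (Fin n) (Fin n) ℝ) (v : EuclideanSpace ℝ (Fin n)) (m : ℕ)
    (k : Fin (stepCount A v m + 1)) : ℝ :=
  ((jacobiMatrix_isHermitian A v (stepCount A v m)).eigenvectorBasis k 0) ^ 2

/-- The `(m+1)`-point Lanczos quadrature of the logarithm for the initial vector `v`. -/
def lanczosQuadrature {n : ℕ} (A : Matrix (Fin n) (Fin n) ℝ) (v : EuclideanSpace ℝ (Fin n))
    (m : ℕ) : ℝ :=
  ∑ k, weight A v m k * Real.log (node A v m k)

/-- The stochastic Lanczos quadrature estimate of `log det A` from the query vectors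
`z 0, …, z (N-1)`, with `m` Lanczos steps for each. -/
def logDetEstimate {n : ℕ} (A : Matrix (Fin n) (Fin n) ℝ) (m N : ℕ) (z : Fin N → Fin n → ℝ) : ℝ :=
  (n : ℝ) / N * ∑ i, lanczosQuadrature A ((√(n : ℝ))⁻¹ • WithLp.toLp 2 (z i)) m

/-- The Rademacher distribution: `+1` and `-1` with probability one half each. -/
def rademacher : Measure ℝ :=
  (2⁻¹ : ENNReal) • Measure.dirac 1 + (2⁻¹ : ENNReal) • Measure.dirac (-1)

/-- The elliptical radius `ρ₁` as a function of the condition number. -/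
def rho (κ : ℝ) : ℝ := (√(2 * κ + 1) + 1) / (√(2 * κ + 1) - 1)

/-- The constant `M_{ρ₁}`. -/
def boundM (κ : ℝ) : ℝ := 5 * Real.log (2 * (κ + 1))

/-- The constant `K_{ρ₁}`. -/
def boundK (κ : ℝ) : ℝ := 8 * boundM κ / (rho κ ^ 2 - rho κ)

end SLQ

end

/-! The error splits into a Monte Carlo part and a quadrature part, each at most `ε n / 2`. With `x
= z / √n`, the form `xᵀ log(A) x` has mean `log det A / n` and lies in `[log lmin, log lmax]` for
sign vectors, so Hoeffding's inequality controls the average over the queries (`integral_logForm`,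
`measureReal_abs_sum_sub_ge_le`).

The quadrature part is deterministic. The Lanczos vectors form an isometry `V` with `Vᵀ A V = T`,
and `A^j v₁ = V T^j e₁` for `j ≤ m`. Hence `T` reproduces all moments up to degree `2 m + 1`, and
the rule is exact for polynomials of that degree (`sum_weight_mul_eval`). The spectral measure and
the rule are probability measures on `[lmin, lmax]`, so the error is at most twice that of any
uniform approximation of `log` by such a polynomial. Node symmetry plays no role.

The polynomial is explicit: for `r = (√κ - 1) / (√κ + 1)` the spectral interval is parametrized by
`t = c |1 + r e^{iθ}|²`, so `log t = log c + 2 Re log (1 + r e^{iθ})`. Truncating the Taylor series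
of `log (1 + z)` gives a Chebyshev sum with geometric error in `r ≤ 1 / ρ₁`
(`exists_polynomial_abs_log_sub_le`, `two_mul_geometric_le`). -/

noncomputable section

namespace SLQ

/-! ### Moments of the spectral measure of a symmetric matrix. -/

section Spectral

variable {ι : Type*} [Fintype ι] [DecidableEq ι] {M : Matrix ι ι ℝ}

theorem inner_toEuclideanLin_right (hM : M.IsHermitian) (x y : EuclideanSpace ℝ ι) :
    ⟪x, M.toEuclideanLin y⟫ = ⟪M.toEuclideanLin x, y⟫ :=
  (Matrix.isSymmetric_toEuclideanLin_iff.mpr hM x y).symm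

theorem toEuclideanLin_eigenvectorBasis (hM : M.IsHermitian) (k : ι) :
    M.toEuclideanLin (hM.eigenvectorBasis k) = hM.eigenvalues k • hM.eigenvectorBasis k := by
  have h := hM.mulVec_eigenvectorBasis k
  ext i
  simpa [Matrix.toLpLin_apply] using congrFun h i

theorem inner_eigenvectorBasis_pow (hM : M.IsHermitian) (k : ι) (j : ℕ)
    (w : EuclideanSpace ℝ ι) :
    ⟪hM.eigenvectorBasis k, (M.toEuclideanLin ^ j) w⟫
      = hM.eigenvalues k ^ j * ⟪hM.eigenvectorBasis k, w⟫ := by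
  induction j with
  | zero => simp
  | succ j ih =>
    rw [pow_succ', Module.End.mul_apply, inner_toEuclideanLin_right hM,
      toEuclideanLin_eigenvectorBasis, inner_smul_left, ih]
    simp [pow_succ']; ring

/-- The moments of the spectral measure of `M` at `w`. -/
theorem inner_pow_eq_sum_eigenvalues (hM : M.IsHermitian) (j : ℕ) (w : EuclideanSpace ℝ ι) :
    ⟪w, (M.toEuclideanLin ^ j) w⟫
      = ∑ k, ⟪hM.eigenvectorBasis k, w⟫ ^ 2 * hM.eigenvalues k ^ j := by
  rw [← hM.eigenvectorBasis.sum_inner_mul_inner]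
  refine Finset.sum_congr rfl fun k _ => ?_
  rw [inner_eigenvectorBasis_pow, real_inner_comm]; ring

theorem sum_sq_inner_eigenvectorBasis (hM : M.IsHermitian) (w : EuclideanSpace ℝ ι) :
    ∑ k, ⟪hM.eigenvectorBasis k, w⟫ ^ 2 = ‖w‖ ^ 2 := by
  simpa using (inner_pow_eq_sum_eigenvalues hM 0 w).symm

end Spectral

/-! ### The Lanczos basis and compression to the Krylov space. -/

section Lanczos

variable {n : ℕ} {A : Matrix (Fin n) (Fin n) ℝ} {x : EuclideanSpace ℝ (Fin n)}

/-- Three-term recurrence. -/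
theorem toEuclideanLin_lanczos_cur (A : Matrix (Fin n) (Fin n) ℝ) (x : EuclideanSpace ℝ (Fin n))
    (k : ℕ) :
    A.toEuclideanLin (lanczos A x k).cur = offCoeff A x k • (lanczos A x (k + 1)).cur
      + diagCoeff A x k • (lanczos A x k).cur + (lanczos A x k).beta • (lanczos A x k).prev := by
  have h : offCoeff A x k • (lanczos A x (k + 1)).cur = (lanczos A x k).residual A := by
    change ‖(lanczos A x k).residual A‖ • (‖(lanczos A x k).residual A‖⁻¹ • _) = _
    -- At breakdown the next vector is `0` because `0⁻¹ = 0`, and the recurrence survives.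
    by_cases h0 : (lanczos A x k).residual A = 0
    · simp [h0]
    · rw [smul_smul, mul_inv_cancel₀ (norm_ne_zero_iff.mpr h0), one_smul]
  rw [h, LanczosState.residual, diagCoeff]
  abel

theorem toEuclideanLin_lanczos_cur_zero (A : Matrix (Fin n) (Fin n) ℝ)
    (x : EuclideanSpace ℝ (Fin n)) :
    A.toEuclideanLin (lanczos A x 0).cur = offCoeff A x 0 • (lanczos A x 1).cur
      + diagCoeff A x 0 • (lanczos A x 0).cur := by
  simpa [lanczos] using toEuclideanLin_lanczos_cur A x 0

theorem toEuclideanLin_lanczos_cur_succ (A : Matrix (Fin n) (Fin n) ℝ)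
    (x : EuclideanSpace ℝ (Fin n)) (k : ℕ) :
    A.toEuclideanLin (lanczos A x (k + 1)).cur = offCoeff A x (k + 1) • (lanczos A x (k + 2)).cur
      + diagCoeff A x (k + 1) • (lanczos A x (k + 1)).cur
      + offCoeff A x k • (lanczos A x k).cur :=
  toEuclideanLin_lanczos_cur A x (k + 1)

/-- For orthonormal Lanczos vectors, the inner product of a Lanczos vector with the image of a
later one is the corresponding off-diagonal entry of the Jacobi matrix. -/
theorem inner_lanczos_cur_toEuclideanLin (hA : A.IsHermitian) {k i : ℕ} (hik : i < k)
    (h : ∀ i ≤ k, ∀ j ≤ k, ⟪(lanczos A x i).cur, (lanczos A x j).cur⟫ = if i = j then 1 else 0) :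
    ⟪(lanczos A x i).cur, A.toEuclideanLin (lanczos A x k).cur⟫
      = if i + 1 = k then offCoeff A x i else 0 := by
  rw [inner_toEuclideanLin_right hA]
  cases i with
  | zero =>
    rw [toEuclideanLin_lanczos_cur_zero, inner_add_left, inner_smul_left, inner_smul_left,
      h 1 (by omega) k le_rfl, h 0 (by omega) k le_rfl, if_neg (by omega : ¬ 0 = k)]
    simp
  | succ i =>
    rw [toEuclideanLin_lanczos_cur_succ, inner_add_left, inner_add_left, inner_smul_left,
      inner_smul_left, inner_smul_left, h (i + 2) (by omega) k le_rfl,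
      h (i + 1) (by omega) k le_rfl, h i (by omega) k le_rfl, if_neg (by omega : ¬ i + 1 = k),
      if_neg (by omega : ¬ i = k)]
    simp

/-- The `α` term cancels the component along `v_k`, the `β` term the one along `v_{k-1}`. Earlier
components vanish because, by symmetry, `A v_i` involves only `v_{i-1}, v_i, v_{i+1}`. -/
theorem inner_lanczos_cur_residual (hA : A.IsHermitian) {k : ℕ}
    (h : ∀ i ≤ k, ∀ j ≤ k, ⟪(lanczos A x i).cur, (lanczos A x j).cur⟫ = if i = j then 1 else 0)
    {i : ℕ} (hi : i ≤ k) : ⟪(lanczos A x i).cur, (lanczos A x k).residual A⟫ = 0 := by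
  have hp : ⟪(lanczos A x i).cur, (lanczos A x k).beta • (lanczos A x k).prev⟫
      = if i + 1 = k then offCoeff A x i else 0 := by
    cases k with
    | zero => simp [lanczos]
    | succ k =>
      change ⟪(lanczos A x i).cur, offCoeff A x k • (lanczos A x k).cur⟫ = _
      rw [inner_smul_right, h i hi k (by omega)]
      by_cases hik : i = k
      · simp [hik]
      · simp [hik]
  rw [LanczosState.residual, inner_sub_right, inner_sub_right, hp, inner_smul_right,
    h i hi k le_rfl]
  rcases hi.eq_or_lt with rfl | hlt
  · simp [LanczosState.alpha]
  · rw [inner_lanczos_cur_toEuclideanLin hA hlt h, if_neg hlt.ne]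
    simp

theorem inner_lanczos_cur_lanczos_cur (hA : A.IsHermitian) (hx : x ≠ 0) {d : ℕ}
    (hd : ∀ k < d, offCoeff A x k ≠ 0) :
    ∀ i ≤ d, ∀ j ≤ d, ⟪(lanczos A x i).cur, (lanczos A x j).cur⟫ = if i = j then 1 else 0 := by
  induction d with
  | zero =>
    intro i hi j hj
    obtain rfl : i = 0 := by omega
    obtain rfl : j = 0 := by omega
    have : ‖x‖ ≠ 0 := norm_ne_zero_iff.mpr hx
    simp [lanczos, norm_smul, this]
  | succ d ih =>
    have h := ih fun k hk => hd k (by omega)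
    have hr : ∀ i ≤ d, ⟪(lanczos A x i).cur, (lanczos A x (d + 1)).cur⟫ = 0 := by
      intro i hi
      change ⟪_, ‖(lanczos A x d).residual A‖⁻¹ • (lanczos A x d).residual A⟫ = 0
      rw [inner_smul_right, inner_lanczos_cur_residual hA h hi, mul_zero]
    have hn : ⟪(lanczos A x (d + 1)).cur, (lanczos A x (d + 1)).cur⟫ = 1 := by
      have h0 : ‖(lanczos A x d).residual A‖ ≠ 0 := hd d (by omega)
      rw [real_inner_self_eq_norm_sq]
      change ‖‖(lanczos A x d).residual A‖⁻¹ • (lanczos A x d).residual A‖ ^ 2 = 1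
      rw [norm_smul, norm_inv, norm_norm, inv_mul_cancel₀ h0, one_pow]
    intro i hi j hj
    rcases hi.eq_or_lt with rfl | hi' <;> rcases hj.eq_or_lt with rfl | hj'
    · simpa using hn
    · rw [real_inner_comm, hr j (by omega), if_neg (by omega)]
    · rw [hr i (by omega), if_neg (by omega)]
    · exact h i (by omega) j (by omega)

/-- The linear map sending the `i`-th standard basis vector to the `i`-th Lanczos vector. -/
def ritzMap (A : Matrix (Fin n) (Fin n) ℝ) (x : EuclideanSpace ℝ (Fin n)) (d : ℕ) :
    EuclideanSpace ℝ (Fin (d + 1)) →ₗ[ℝ] EuclideanSpace ℝ (Fin n) :=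
  (Fintype.linearCombination ℝ fun i : Fin (d + 1) => (lanczos A x i).cur) ∘ₗ
    (WithLp.linearEquiv 2 ℝ (Fin (d + 1) → ℝ)).toLinearMap

theorem ritzMap_apply (d : ℕ) (y : EuclideanSpace ℝ (Fin (d + 1))) :
    ritzMap A x d y = ∑ i, y i • (lanczos A x i).cur := by
  simp [ritzMap, Fintype.linearCombination_apply]

theorem ritzMap_single (d : ℕ) (i : Fin (d + 1)) :
    ritzMap A x d (EuclideanSpace.single i 1) = (lanczos A x i).cur := by
  simp [ritzMap_apply]

theorem inner_ritzMap_ritzMap (hA : A.IsHermitian) (hx : x ≠ 0) {d : ℕ}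
    (hd : ∀ k < d, offCoeff A x k ≠ 0) (y w : EuclideanSpace ℝ (Fin (d + 1))) :
    ⟪ritzMap A x d y, ritzMap A x d w⟫ = ⟪y, w⟫ := by
  have h := inner_lanczos_cur_lanczos_cur hA hx hd
  simp_rw [ritzMap_apply, sum_inner, inner_sum, inner_smul_left, inner_smul_right]
  simp_rw [fun i j : Fin (d + 1) => h i (by omega) j (by omega), ← Fin.ext_iff]
  simp [PiLp.inner_apply, mul_comm]

theorem inner_lanczos_eq_jacobiMatrix (hA : A.IsHermitian) (hx : x ≠ 0) {d : ℕ}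
    (hd : ∀ k < d, offCoeff A x k ≠ 0) (i j : Fin (d + 1)) :
    ⟪(lanczos A x i).cur, A.toEuclideanLin (lanczos A x j).cur⟫ = jacobiMatrix A x d i j := by
  have key : ∀ i j : Fin (d + 1), i < j →
      ⟪(lanczos A x i).cur, A.toEuclideanLin (lanczos A x j).cur⟫ = jacobiMatrix A x d i j := by
    intro i j hij
    have hij' : (i : ℕ) < j := hij
    rw [inner_lanczos_cur_toEuclideanLin hA hij' fun a ha b hb =>
      inner_lanczos_cur_lanczos_cur hA hx hd a (by omega) b (by omega)]
    simp only [jacobiMatrix, Matrix.of_apply, if_neg hij.ne]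
    split_ifs <;> first | rfl | omega
  rcases lt_trichotomy i j with hij | rfl | hij
  · exact key i j hij
  · simp [jacobiMatrix, diagCoeff, LanczosState.alpha]
  · rw [inner_toEuclideanLin_right hA, real_inner_comm, key j i hij]
    exact (jacobiMatrix_isHermitian A x d).apply i j

theorem inner_ritzMap_toEuclideanLin (hA : A.IsHermitian) (hx : x ≠ 0) {d : ℕ}
    (hd : ∀ k < d, offCoeff A x k ≠ 0) (y w : EuclideanSpace ℝ (Fin (d + 1))) :
    ⟪ritzMap A x d y, A.toEuclideanLin (ritzMap A x d w)⟫
      = ⟪y, (jacobiMatrix A x d).toEuclideanLin w⟫ := by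
  simp_rw [ritzMap_apply, map_sum, map_smul, sum_inner, inner_sum, inner_smul_left,
    inner_smul_right, inner_lanczos_eq_jacobiMatrix hA hx hd]
  simp only [PiLp.inner_apply, Matrix.toLpLin_apply, Matrix.mulVec, dotProduct, conj_trivial,
    RCLike.inner_apply, Finset.sum_mul]
  exact Finset.sum_congr rfl fun i _ => Finset.sum_congr rfl fun j _ => by ring

/-- Compression gives only `Vᵀ A V = T`. Once `A V w` already lies in the range of the isometry `V`,
no projection is lost and `A V w = V T w`. -/
theorem toEuclideanLin_ritzMap (hA : A.IsHermitian) (hx : x ≠ 0) {d : ℕ}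
    (hd : ∀ k < d, offCoeff A x k ≠ 0) {w : EuclideanSpace ℝ (Fin (d + 1))}
    (hw : A.toEuclideanLin (ritzMap A x d w) ∈ LinearMap.range (ritzMap A x d)) :
    A.toEuclideanLin (ritzMap A x d w)
      = ritzMap A x d ((jacobiMatrix A x d).toEuclideanLin w) := by
  obtain ⟨y, hy⟩ := hw
  rw [← hy]
  congr 1
  refine ext_inner_left ℝ fun u => ?_
  rw [← inner_ritzMap_ritzMap hA hx hd, hy, inner_ritzMap_toEuclideanLin hA hx hd]

theorem lanczos_cur_mem_range_ritzMap {d k : ℕ} (hk : k ≤ d) :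
    (lanczos A x k).cur ∈ LinearMap.range (ritzMap A x d) :=
  ⟨EuclideanSpace.single ⟨k, by omega⟩ 1, by rw [ritzMap_single]⟩

/-- The image of a Lanczos vector lies in the span of the Lanczos vectors up to the next one. -/
theorem toEuclideanLin_lanczos_cur_mem_span (k : ℕ) :
    A.toEuclideanLin (lanczos A x k).cur
      ∈ Submodule.span ℝ ((fun i => (lanczos A x i).cur) '' Set.Iic (k + 1)) := by
  have hm : ∀ i ≤ k + 1, (lanczos A x i).cur
      ∈ Submodule.span ℝ ((fun i => (lanczos A x i).cur) '' Set.Iic (k + 1)) :=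
    fun i hi => Submodule.subset_span ⟨i, hi, rfl⟩
  cases k with
  | zero =>
    rw [toEuclideanLin_lanczos_cur_zero]
    exact add_mem (Submodule.smul_mem _ _ (hm _ (by omega)))
      (Submodule.smul_mem _ _ (hm _ (by omega)))
  | succ k =>
    rw [toEuclideanLin_lanczos_cur_succ]
    exact add_mem (add_mem (Submodule.smul_mem _ _ (hm _ (by omega)))
      (Submodule.smul_mem _ _ (hm _ (by omega)))) (Submodule.smul_mem _ _ (hm _ (by omega)))

theorem pow_toEuclideanLin_mem_span (j : ℕ) :
    (A.toEuclideanLin ^ j) (lanczos A x 0).cur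
      ∈ Submodule.span ℝ ((fun i => (lanczos A x i).cur) '' Set.Iic j) := by
  induction j with
  | zero => exact Submodule.subset_span ⟨0, by simp, by simp⟩
  | succ j ih =>
    rw [pow_succ', Module.End.mul_apply]
    refine (Submodule.span_le (p := Submodule.comap A.toEuclideanLin (Submodule.span ℝ
      ((fun i => (lanczos A x i).cur) '' Set.Iic (j + 1))))).mpr ?_ ih
    rintro _ ⟨i, hi, rfl⟩
    refine Submodule.span_mono (Set.image_mono fun a ha => ?_)
      (toEuclideanLin_lanczos_cur_mem_span (A := A) (x := x) i)
    simp only [Set.mem_Iic] at ha hi ⊢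
    omega

theorem pow_toEuclideanLin_mem_range {d j : ℕ} (hj : j ≤ d) :
    (A.toEuclideanLin ^ j) (lanczos A x 0).cur ∈ LinearMap.range (ritzMap A x d) := by
  refine Submodule.span_le.mpr ?_ (pow_toEuclideanLin_mem_span (A := A) (x := x) j)
  rintro _ ⟨i, hi, rfl⟩
  exact lanczos_cur_mem_range_ritzMap (le_trans hi hj)

/-- If the iteration breaks down, the Krylov space is invariant. -/
theorem pow_toEuclideanLin_mem_range_of_offCoeff_eq_zero {d : ℕ} (h0 : offCoeff A x d = 0)
    (j : ℕ) :
    (A.toEuclideanLin ^ j) (lanczos A x 0).cur ∈ LinearMap.range (ritzMap A x d) := by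
  induction j with
  | zero => exact lanczos_cur_mem_range_ritzMap (Nat.zero_le d)
  | succ j ih =>
    rw [pow_succ', Module.End.mul_apply]
    obtain ⟨w, hw⟩ := ih
    rw [← hw, ritzMap_apply, map_sum]
    refine Submodule.sum_mem _ fun i _ => ?_
    rw [map_smul]
    refine Submodule.smul_mem _ _ ?_
    -- Only the image of the last vector could leave the span, through the term whose coefficient is
    -- now zero.
    rcases (Nat.lt_succ_iff.mp i.2).eq_or_lt with hi | hi
    · rw [hi]
      have hk : ∀ k ≤ d, (lanczos A x k).cur ∈ LinearMap.range (ritzMap A x d) :=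
        fun k hk => lanczos_cur_mem_range_ritzMap hk
      cases d with
      | zero =>
        rw [toEuclideanLin_lanczos_cur_zero, h0, zero_smul, zero_add (_ • _)]
        exact Submodule.smul_mem _ _ (hk _ le_rfl)
      | succ d =>
        rw [toEuclideanLin_lanczos_cur_succ, h0, zero_smul, zero_add (_ • _)]
        exact add_mem (Submodule.smul_mem _ _ (hk _ le_rfl))
          (Submodule.smul_mem _ _ (hk _ (by omega)))
    · refine Submodule.span_le.mpr ?_ (toEuclideanLin_lanczos_cur_mem_span (A := A) (x := x) i)
      rintro _ ⟨k, hk, rfl⟩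
      exact lanczos_cur_mem_range_ritzMap (le_trans hk hi)

theorem pow_toEuclideanLin_eq_ritzMap (hA : A.IsHermitian) (hx : x ≠ 0) {d : ℕ}
    (hd : ∀ k < d, offCoeff A x k ≠ 0) {j : ℕ}
    (hj : ∀ i ≤ j, (A.toEuclideanLin ^ i) (lanczos A x 0).cur ∈ LinearMap.range (ritzMap A x d)) :
    (A.toEuclideanLin ^ j) (lanczos A x 0).cur
      = ritzMap A x d (((jacobiMatrix A x d).toEuclideanLin ^ j) (EuclideanSpace.single 0 1)) := by
  induction j with
  | zero => rw [pow_zero, pow_zero, Module.End.one_apply, Module.End.one_apply, ritzMap_single]; rfl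
  | succ j ih =>
    have h := ih fun i hi => hj i (by omega)
    have hr := hj (j + 1) le_rfl
    rw [pow_succ', Module.End.mul_apply, h] at hr
    rw [pow_succ', pow_succ', Module.End.mul_apply, Module.End.mul_apply, h,
      toEuclideanLin_ritzMap hA hx hd hr]

/-! ### Moment matching and Gauss quadrature. -/

theorem inner_pow_add {ι : Type*} [Fintype ι] [DecidableEq ι] {M : Matrix ι ι ℝ}
    (hM : M.IsHermitian) (a b : ℕ) (w : EuclideanSpace ℝ ι) :
    ⟪w, (M.toEuclideanLin ^ (a + b)) w⟫
      = ⟪(M.toEuclideanLin ^ a) w, (M.toEuclideanLin ^ b) w⟫ := by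
  rw [pow_add, Module.End.mul_apply]
  exact ((Matrix.isSymmetric_toEuclideanLin_iff.mpr hM).pow a _ _).symm

theorem offCoeff_ne_zero_of_lt_stepCount {m k : ℕ} (hk : k < stepCount A x m) :
    offCoeff A x k ≠ 0 := fun h => by
  have : k ∉ {k : ℕ | k = m ∨ offCoeff A x k = 0} := Nat.notMem_of_lt_sInf hk
  exact this (Or.inr h)

theorem stepCount_eq_or_offCoeff_eq_zero (A : Matrix (Fin n) (Fin n) ℝ)
    (x : EuclideanSpace ℝ (Fin n)) (m : ℕ) :
    stepCount A x m = m ∨ offCoeff A x (stepCount A x m) = 0 :=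
  Nat.sInf_mem (s := {k : ℕ | k = m ∨ offCoeff A x k = 0}) ⟨m, Or.inl rfl⟩

/-- The Jacobi matrix reproduces the moments of degree at most `2 m + 1`. -/
theorem inner_pow_jacobiMatrix (hA : A.IsHermitian) (hx : x ≠ 0) {m j : ℕ}
    (hj : j ≤ 2 * m + 1) :
    ⟪EuclideanSpace.single 0 1,
        ((jacobiMatrix A x (stepCount A x m)).toEuclideanLin ^ j) (EuclideanSpace.single 0 1)⟫
      = ⟪(lanczos A x 0).cur, (A.toEuclideanLin ^ j) (lanczos A x 0).cur⟫ := by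
  have hd : ∀ k < stepCount A x m, offCoeff A x k ≠ 0 :=
    fun k hk => offCoeff_ne_zero_of_lt_stepCount hk
  have hT := jacobiMatrix_isHermitian A x (stepCount A x m)
  rcases stepCount_eq_or_offCoeff_eq_zero A x m with h | h
  · have hp : ∀ j ≤ m, _ := fun j hj => pow_toEuclideanLin_eq_ritzMap hA hx hd (j := j)
      fun i hi => pow_toEuclideanLin_mem_range (by omega)
    rcases Nat.lt_or_ge m j with hmj | hmj
    -- With `b ≤ m`, write the moment as `⟨A^m v₁, A (A^b v₁)⟩`. Both powers are lifted from `T`,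
    -- and the middle factor `A` is handled by `Vᵀ A V = T`; this gains the degree `2 m + 1`.
    · obtain ⟨b, rfl⟩ : ∃ b, j = m + (1 + b) := ⟨j - m - 1, by omega⟩
      rw [inner_pow_add hA, inner_pow_add hT, pow_add _ 1 b, pow_add _ 1 b, Module.End.mul_apply,
        Module.End.mul_apply, hp m le_rfl, hp b (by omega), pow_one, pow_one,
        inner_ritzMap_toEuclideanLin hA hx hd]
    · have h0 := hp 0 (by omega)
      rw [pow_zero, pow_zero, Module.End.one_apply, Module.End.one_apply] at h0
      rw [hp j hmj, h0, inner_ritzMap_ritzMap hA hx hd]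
  · have hp : ∀ j, _ := fun j => pow_toEuclideanLin_eq_ritzMap hA hx hd (j := j)
      fun i _ => pow_toEuclideanLin_mem_range_of_offCoeff_eq_zero h i
    have h0 := hp 0
    rw [pow_zero, pow_zero, Module.End.one_apply, Module.End.one_apply] at h0
    rw [hp j, h0, inner_ritzMap_ritzMap hA hx hd]

theorem weight_eq_inner_sq (m : ℕ) (k : Fin (stepCount A x m + 1)) :
    weight A x m k = ⟪(jacobiMatrix_isHermitian A x (stepCount A x m)).eigenvectorBasis k,
      EuclideanSpace.single 0 1⟫ ^ 2 := by
  rw [weight, EuclideanSpace.inner_single_right, one_mul, conj_trivial]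

theorem weight_nonneg (m : ℕ) (k : Fin (stepCount A x m + 1)) : 0 ≤ weight A x m k :=
  sq_nonneg _

theorem sum_weight (A : Matrix (Fin n) (Fin n) ℝ) (x : EuclideanSpace ℝ (Fin n)) (m : ℕ) :
    ∑ k, weight A x m k = 1 := by
  simp_rw [weight_eq_inner_sq, sum_sq_inner_eigenvectorBasis]
  simp

theorem lanczos_zero_cur (A : Matrix (Fin n) (Fin n) ℝ) (hx : ‖x‖ = 1) :
    (lanczos A x 0).cur = x := by
  simp [lanczos, hx]

/-- The Lanczos quadrature is a Gauss quadrature: it is exact for polynomials of degree at most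
`2 m + 1`. -/
theorem sum_weight_mul_eval (hA : A.IsHermitian) (hx : ‖x‖ = 1) {m : ℕ} {p : Polynomial ℝ}
    (hp : p.natDegree ≤ 2 * m + 1) :
    ∑ k, weight A x m k * p.eval (node A x m k)
      = ∑ k, ⟪hA.eigenvectorBasis k, x⟫ ^ 2 * p.eval (hA.eigenvalues k) := by
  have hx0 : x ≠ 0 := by rintro rfl; simp at hx
  simp_rw [Polynomial.eval_eq_sum_range, Finset.mul_sum]
  rw [Finset.sum_comm, Finset.sum_comm (s := Finset.univ (α := Fin n))]
  refine Finset.sum_congr rfl fun j hj => ?_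
  have h := inner_pow_jacobiMatrix hA hx0 (m := m) (j := j)
    (by have := Finset.mem_range.mp hj; omega)
  rw [lanczos_zero_cur A hx, inner_pow_eq_sum_eigenvalues hA,
    inner_pow_eq_sum_eigenvalues (jacobiMatrix_isHermitian A x (stepCount A x m))] at h
  simp_rw [mul_left_comm _ (p.coeff j), ← Finset.mul_sum, ← h, weight_eq_inner_sq]
  rfl

theorem inner_toEuclideanLin_self_mem_Icc {ι : Type*} [Fintype ι] [DecidableEq ι]
    {M : Matrix ι ι ℝ} (hM : M.IsHermitian) {a b : ℝ} (h : ∀ k, hM.eigenvalues k ∈ Set.Icc a b)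
    {w : EuclideanSpace ℝ ι} (hw : ‖w‖ = 1) : ⟪w, M.toEuclideanLin w⟫ ∈ Set.Icc a b := by
  have h1 := inner_pow_eq_sum_eigenvalues hM 1 w
  have h2 := sum_sq_inner_eigenvectorBasis hM w
  simp only [pow_one] at h1
  rw [hw, one_pow] at h2
  rw [h1]
  constructor
  · calc a = ∑ k, ⟪hM.eigenvectorBasis k, w⟫ ^ 2 * a := by rw [← Finset.sum_mul, h2, one_mul]
      _ ≤ _ := Finset.sum_le_sum fun k _ => mul_le_mul_of_nonneg_left (h k).1 (sq_nonneg _)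
  · calc _ ≤ ∑ k, ⟪hM.eigenvectorBasis k, w⟫ ^ 2 * b :=
          Finset.sum_le_sum fun k _ => mul_le_mul_of_nonneg_left (h k).2 (sq_nonneg _)
      _ = b := by rw [← Finset.sum_mul, h2, one_mul]

/-- A node is the Rayleigh quotient of `A` at the unit vector `V y`, where `y` is the corresponding
eigenvector of `T`. -/
theorem node_mem_Icc (hA : A.IsHermitian) (hx : x ≠ 0) {a b : ℝ}
    (h : ∀ k, hA.eigenvalues k ∈ Set.Icc a b) (m : ℕ) (k : Fin (stepCount A x m + 1)) :
    node A x m k ∈ Set.Icc a b := by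
  have hd : ∀ k < stepCount A x m, offCoeff A x k ≠ 0 :=
    fun k hk => offCoeff_ne_zero_of_lt_stepCount hk
  have hT := jacobiMatrix_isHermitian A x (stepCount A x m)
  have hn : ‖ritzMap A x (stepCount A x m) (hT.eigenvectorBasis k)‖ = 1 := by
    rw [norm_eq_sqrt_real_inner, inner_ritzMap_ritzMap hA hx hd]
    simp
  have := inner_toEuclideanLin_self_mem_Icc hA h hn
  rw [inner_ritzMap_toEuclideanLin hA hx hd, toEuclideanLin_eigenvectorBasis hT,
    inner_smul_right] at this
  simpa [node] using this

end Lanczos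

/-! ### Chebyshev approximation of the logarithm. -/

section Approximation

open Polynomial

theorem log_one_add_two_mul_cos {r : ℝ} (θ : ℝ) :
    Real.log (1 + 2 * r * Real.cos θ + r ^ 2)
      = 2 * (Complex.log (1 + r * Complex.exp (θ * Complex.I))).re := by
  have h : ‖(1 + r * Complex.exp (θ * Complex.I) : ℂ)‖ ^ 2 = 1 + 2 * r * Real.cos θ + r ^ 2 := by
    rw [← Complex.normSq_eq_norm_sq, Complex.normSq_apply]
    simp only [Complex.add_re, Complex.one_re, Complex.re_ofReal_mul, Complex.exp_ofReal_mul_I_re,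
      Complex.add_im, Complex.one_im, Complex.im_ofReal_mul, Complex.exp_ofReal_mul_I_im]
    linear_combination r ^ 2 * Real.sin_sq_add_cos_sq θ
  rw [Complex.log_re, ← h, Real.log_pow]
  norm_num

/-- The truncated Chebyshev expansion of `x ↦ log (1 + 2 r x + r ^ 2)`. -/
def logChebyshev (r : ℝ) (K : ℕ) : ℝ[X] :=
  ∑ k ∈ Finset.range (K + 1), C (2 * ((-1) ^ (k + 1) * r ^ k / k)) * Chebyshev.T ℝ k

theorem natDegree_logChebyshev_le (r : ℝ) (K : ℕ) : (logChebyshev r K).natDegree ≤ K := by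
  refine natDegree_sum_le_of_forall_le _ _ fun k hk => ?_
  refine (natDegree_C_mul_le _ _).trans ?_
  rw [Chebyshev.natDegree_T]
  have := Finset.mem_range.mp hk
  simp only [Int.natAbs_natCast]
  omega

/-- Termwise, `Re (r e^{iθ})^k = r^k T_k (cos θ)`. The terms with `k = 0` vanish on both sides since
`x / 0 = 0`. -/
theorem eval_logChebyshev_cos (r θ : ℝ) (K : ℕ) :
    (logChebyshev r K).eval (Real.cos θ)
      = 2 * (Complex.logTaylor (K + 1) (r * Complex.exp (θ * Complex.I))).re := by
  rw [logChebyshev, eval_finsetSum, Complex.logTaylor, Complex.re_sum, Finset.mul_sum]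
  refine Finset.sum_congr rfl fun k _ => ?_
  have h : ((-1) ^ (k + 1) * (r * Complex.exp (θ * Complex.I)) ^ k / k : ℂ)
      = (((-1) ^ (k + 1) * r ^ k / k : ℝ) : ℂ) * Complex.exp ((k * θ : ℝ) * Complex.I) := by
    rw [mul_pow, ← Complex.exp_nat_mul]
    push_cast
    rw [mul_assoc (k : ℂ)]
    ring
  rw [h, Complex.re_ofReal_mul, Complex.exp_ofReal_mul_I_re, eval_mul, eval_C,
    Chebyshev.T_real_cos]
  push_cast
  ring

/-- With `x = cos θ`, this is the Taylor remainder of `log (1 + z)` on `|z| = r`; its further factor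
`1 / (K + 1)` is discarded. -/
theorem abs_log_sub_eval_logChebyshev_le {r x : ℝ} (hr0 : 0 ≤ r) (hr1 : r < 1)
    (hx : x ∈ Set.Icc (-1) 1) (K : ℕ) :
    |Real.log (1 + 2 * r * x + r ^ 2) - (logChebyshev r K).eval x|
      ≤ 2 * (r ^ (K + 1) / (1 - r)) := by
  rw [← Real.cos_arccos hx.1 hx.2, log_one_add_two_mul_cos, eval_logChebyshev_cos, ← mul_sub,
    ← Complex.sub_re, abs_mul, abs_two]
  have hn : ‖(r * Complex.exp (Real.arccos x * Complex.I) : ℂ)‖ = r := by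
    rw [norm_mul, Complex.norm_exp_ofReal_mul_I, mul_one, Complex.norm_real, Real.norm_eq_abs,
      abs_of_nonneg hr0]
  refine mul_le_mul_of_nonneg_left ?_ two_pos.le
  refine (Complex.abs_re_le_norm _).trans
    ((Complex.norm_log_sub_logTaylor_le K (hn.symm ▸ hr1)).trans ?_)
  rw [hn, ← div_eq_mul_inv]
  refine div_le_self (div_nonneg (pow_nonneg hr0 _) (by linarith)) ?_
  have : (0 : ℝ) ≤ K := K.cast_nonneg
  linarith

/-- Polynomial approximation of the logarithm on an interval of positive numbers. -/
theorem exists_polynomial_abs_log_sub_le {a b r : ℝ} (ha : 0 < a) (hr0 : 0 ≤ r) (hr1 : r < 1)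
    (hab : b * (1 - r) ^ 2 = a * (1 + r) ^ 2) (K : ℕ) :
    ∃ p : ℝ[X], p.natDegree ≤ K ∧
      ∀ t ∈ Set.Icc a b, |Real.log t - p.eval t| ≤ 2 * (r ^ (K + 1) / (1 - r)) := by
  have h1r : 0 < 1 - r := by linarith
  -- This scale makes `x ↦ c (1 + 2 r x + r²)` send `-1` to `a` and `1` to `b`.
  set c := a / (1 - r) ^ 2 with hc
  have hc0 : 0 < c := by positivity
  have hac : a = c * (1 - r) ^ 2 := by rw [hc]; field_simp
  have hbc : b = c * (1 + r) ^ 2 := by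
    have : b * (1 - r) ^ 2 = (c * (1 + r) ^ 2) * (1 - r) ^ 2 := by rw [hab, hac]; ring
    exact mul_right_cancel₀ (by positivity) this
  refine ⟨C (Real.log c) + (logChebyshev r K).comp
    (C (1 / (2 * r * c)) * X + C (-(1 + r ^ 2) / (2 * r))), ?_, fun t ht => ?_⟩
  · refine (natDegree_add_le _ _).trans (max_le (by simp) ?_)
    refine natDegree_comp_le.trans ?_
    calc _ ≤ K * 1 := Nat.mul_le_mul (natDegree_logChebyshev_le r K) natDegree_linear_le
      _ = K := mul_one K
  · set x := 1 / (2 * r * c) * t + -(1 + r ^ 2) / (2 * r) with hx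
    have hxt : t = c * (1 + 2 * r * x + r ^ 2) ∧ x ∈ Set.Icc (-1 : ℝ) 1 := by
      -- If `r = 0`, the interval is the single point `c`, and division by zero makes `x = 0`.
      rcases hr0.eq_or_lt with rfl | hr
      · have : t = c := le_antisymm (by have := ht.2; rw [hbc] at this; linarith)
          (by have := ht.1; rw [hac] at this; linarith)
        refine ⟨by simp [this], ?_⟩
        rw [hx]; simp
      · have hxt : t = c * (1 + 2 * r * x + r ^ 2) := by rw [hx]; field_simp; ring
        refine ⟨hxt, ?_⟩
        have hpos : 0 < 2 * (c * r) := by positivity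
        have h1 := ht.1
        have h2 := ht.2
        rw [hxt] at h1 h2
        rw [hac] at h1
        rw [hbc] at h2
        constructor
        · refine le_of_mul_le_mul_left ?_ hpos
          linarith
        · refine le_of_mul_le_mul_left ?_ hpos
          linarith
    have hpos : 0 < 1 + 2 * r * x + r ^ 2 := by
      have : 0 < t := ha.trans_le ht.1
      rw [hxt.1] at this
      exact pos_of_mul_pos_right this hc0.le
    have hlog : Real.log t = Real.log c + Real.log (1 + 2 * r * x + r ^ 2) := by
      rw [hxt.1, Real.log_mul hc0.ne' hpos.ne']
    rw [hlog, eval_add, eval_C, eval_comp, eval_add, eval_mul, eval_C, eval_C, eval_X, ← hx,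
      add_sub_add_left_eq_sub]
    exact abs_log_sub_eval_logChebyshev_le hr0 hr1 hxt.2 K

end Approximation

/-! ### Error of the Lanczos quadrature. -/

section QuadratureError

variable {n : ℕ} {A : Matrix (Fin n) (Fin n) ℝ} {x : EuclideanSpace ℝ (Fin n)}

theorem abs_sum_mul_sub_le {ι : Type*} [Fintype ι] {w f g : ι → ℝ} (hw : ∀ i, 0 ≤ w i)
    (hs : ∑ i, w i = 1) {δ : ℝ} (h : ∀ i, |f i - g i| ≤ δ) :
    |∑ i, w i * f i - ∑ i, w i * g i| ≤ δ := by
  rw [← Finset.sum_sub_distrib]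
  calc _ ≤ ∑ i, |w i * f i - w i * g i| := Finset.abs_sum_le_sum_abs _ _
    _ ≤ ∑ i, w i * δ := Finset.sum_le_sum fun i _ => by
        rw [← mul_sub, abs_mul, abs_of_nonneg (hw i)]
        exact mul_le_mul_of_nonneg_left (h i) (hw i)
    _ = δ := by rw [← Finset.sum_mul, hs, one_mul]

/-- The error of the Lanczos quadrature is at most twice the error of uniform polynomial
approximation. -/
theorem abs_sub_lanczosQuadrature_le (hA : A.IsHermitian) (hx : ‖x‖ = 1) {a b δ : ℝ}
    (hspec : ∀ k, hA.eigenvalues k ∈ Set.Icc a b) {m : ℕ} {p : Polynomial ℝ}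
    (hp : p.natDegree ≤ 2 * m + 1) (hδ : ∀ t ∈ Set.Icc a b, |Real.log t - p.eval t| ≤ δ) :
    |∑ k, ⟪hA.eigenvectorBasis k, x⟫ ^ 2 * Real.log (hA.eigenvalues k)
      - lanczosQuadrature A x m| ≤ 2 * δ := by
  have hx0 : x ≠ 0 := by rintro rfl; simp at hx
  have h1 := abs_sum_mul_sub_le (fun k => sq_nonneg ⟪hA.eigenvectorBasis k, x⟫)
    (by rw [sum_sq_inner_eigenvectorBasis, hx, one_pow]) fun k => hδ _ (hspec k)
  have h2 := abs_sum_mul_sub_le (weight_nonneg (A := A) (x := x) m) (sum_weight A x m)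
    fun k => hδ _ (node_mem_Icc hA hx0 hspec m k)
  rw [sum_weight_mul_eval hA hx hp] at h2
  rw [abs_le] at *
  unfold lanczosQuadrature
  constructor <;> linarith [h1.1, h1.2, h2.1, h2.2]

/-- After clearing denominators the second inequality is `√κ ≤ √(2 κ + 1)`. -/
theorem rho_spec {κ : ℝ} (hκ : 1 ≤ κ) : 1 < rho κ ∧
    (√κ - 1) / (√κ + 1) ≤ (rho κ)⁻¹ := by
  have h1 : 1 ≤ √κ := Real.one_le_sqrt.mpr hκ
  have h2 : √κ ≤ √(2 * κ + 1) := Real.sqrt_le_sqrt (by linarith)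
  have h3 : 1 < √(2 * κ + 1) := by
    rw [Real.lt_sqrt zero_le_one]
    linarith
  unfold rho
  constructor
  · rw [lt_div_iff₀ (by linarith)]
    linarith
  · rw [inv_div, div_le_div_iff₀ (by linarith) (by linarith)]
    nlinarith

theorem one_le_boundM {κ : ℝ} (hκ : 1 ≤ κ) : 1 ≤ boundM κ := by
  have h1 : Real.log 2 ≤ Real.log (2 * (κ + 1)) := Real.log_le_log two_pos (by linarith)
  have h2 := Real.log_two_gt_d9
  unfold boundM
  linarith

/-- The outer factor 2 counts the two measures being compared, and the exponent is the degree `2 m +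
1` plus one. Replacing the ratio by `ρ⁻¹` leaves `4 / ((ρ² - ρ) ρ^(2 m))`. Of `boundM` only `1 ≤
boundM κ` is needed. -/
theorem two_mul_geometric_le {κ ε : ℝ} (hκ : 1 ≤ κ) (hε : 0 < ε) {m : ℕ}
    (hm : 1 / (2 * Real.log (rho κ)) * Real.log (boundK κ / ε) ≤ (m : ℝ)) :
    2 * (2 * (((√κ - 1) / (√κ + 1)) ^ (2 * m + 1 + 1) / (1 - (√κ - 1) / (√κ + 1)))) ≤ ε / 2 := by
  obtain ⟨hρ, hr⟩ := rho_spec hκ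
  have hM := one_le_boundM hκ
  set ρ := rho κ with hρ_def
  have hρ0 : 0 < ρ := by linarith
  have hlog : 0 < Real.log ρ := Real.log_pos hρ
  have hden : 0 < ρ ^ 2 - ρ := by nlinarith
  have hK : 0 < boundK κ := by unfold boundK; rw [← hρ_def]; positivity
  have hKε : boundK κ ≤ ε * ρ ^ (2 * m) := by
    have h : Real.log (boundK κ / ε) ≤ Real.log (ρ ^ (2 * m)) := by
      rw [one_div, inv_mul_le_iff₀ (by positivity)] at hm
      rw [Real.log_pow]
      push_cast
      linarith
    have := (Real.log_le_log_iff (by positivity) (by positivity)).mp h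
    rw [div_le_iff₀ hε] at this
    linarith
  have h1 : 0 ≤ (√κ - 1) / (√κ + 1) :=
    div_nonneg (by linarith [Real.one_le_sqrt.mpr hκ]) (by positivity)
  have h2 : ρ⁻¹ < 1 := inv_lt_one_of_one_lt₀ hρ
  have h3 : ((√κ - 1) / (√κ + 1)) ^ (2 * m + 1 + 1) / (1 - (√κ - 1) / (√κ + 1))
      ≤ ρ⁻¹ ^ (2 * m + 1 + 1) / (1 - ρ⁻¹) :=
    div_le_div₀ (by positivity) (pow_le_pow_left₀ h1 hr _) (by linarith) (by linarith)
  have h4 : ρ⁻¹ ^ (2 * m + 1 + 1) / (1 - ρ⁻¹) = 1 / ((ρ ^ 2 - ρ) * ρ ^ (2 * m)) := by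
    have : 1 - ρ⁻¹ ≠ 0 := by linarith
    have h' : ρ - 1 ≠ 0 := by linarith
    have h'' : ρ ^ 2 - ρ = ρ * (ρ - 1) := by ring
    rw [h'', show 1 - ρ⁻¹ = (ρ - 1) / ρ by field_simp]
    simp only [pow_add, inv_pow, pow_one]
    field_simp
  have h5 : 8 ≤ ε * ((ρ ^ 2 - ρ) * ρ ^ (2 * m)) := by
    unfold boundK at hKε
    rw [← hρ_def, div_le_iff₀ hden] at hKε
    linarith
  have h6 : 1 / ((ρ ^ 2 - ρ) * ρ ^ (2 * m)) ≤ ε / 8 := by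
    rw [div_le_div_iff₀ (by positivity) (by norm_num)]
    linarith
  linarith

theorem abs_sub_lanczosQuadrature_le_half (hA : A.IsHermitian) (hx : ‖x‖ = 1) {a b : ℝ}
    (ha : 0 < a) (hab : a ≤ b) (hspec : ∀ k, hA.eigenvalues k ∈ Set.Icc a b) {ε : ℝ} (hε : 0 < ε)
    {m : ℕ} (hm : 1 / (2 * Real.log (rho (b / a))) * Real.log (boundK (b / a) / ε) ≤ (m : ℝ)) :
    |∑ k, ⟪hA.eigenvectorBasis k, x⟫ ^ 2 * Real.log (hA.eigenvalues k)
      - lanczosQuadrature A x m| ≤ ε / 2 := by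
  have hκ : 1 ≤ b / a := (one_le_div ha).mpr hab
  have hs : 1 ≤ √(b / a) := Real.one_le_sqrt.mpr hκ
  have hs2 : √(b / a) ^ 2 * a = b := by
    rw [Real.sq_sqrt (by linarith), div_mul_cancel₀ _ ha.ne']
  have hr1 : (√(b / a) - 1) / (√(b / a) + 1) < 1 := by
    rw [div_lt_one (by linarith)]
    linarith
  -- The ratio is the solution `r` of `(1 + r) / (1 - r) = √(b / a)`.
  obtain ⟨p, hp, hpe⟩ := exists_polynomial_abs_log_sub_le (b := b) ha
    (div_nonneg (by linarith) (by linarith) : 0 ≤ (√(b / a) - 1) / (√(b / a) + 1)) hr1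
    (by
      generalize √(b / a) = s at *
      have : s + 1 ≠ 0 := by linarith
      rw [← hs2]
      field_simp
      ring) (2 * m + 1)
  exact (abs_sub_lanczosQuadrature_le hA hx hspec hp hpe).trans (two_mul_geometric_le hκ hε hm)

end QuadratureError

/-! ### Rademacher vectors and Hoeffding's inequality. -/

section Probability

variable {Ω : Type*} [MeasurableSpace Ω] {P : Measure Ω} [IsProbabilityMeasure P]

/-- If the members of a doubly indexed family are independent, then so are its rows. -/
theorem iIndepFun_rows {ι κ : Type*} [Fintype ι] [Fintype κ] {z : ι → κ → Ω → ℝ}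
    (hz : ∀ i j, AEMeasurable (z i j) P) (h : iIndepFun (fun p : ι × κ => z p.1 p.2) P) :
    iIndepFun (fun i ω j => z i j ω) P := by
  have hprob : ∀ i j, IsProbabilityMeasure (P.map (z i j)) :=
    fun i j => Measure.isProbabilityMeasure_map (hz i j)
  have hrow : ∀ i, P.map (fun ω j => z i j ω) = Measure.pi fun j => P.map (z i j) := fun i =>
    (h.precomp (g := fun j : κ => (i, j)) fun _ _ hab => (Prod.ext_iff.mp hab).2).map_fun_eq_pi_map
      (hz i)
  rw [iIndepFun_iff_map_fun_eq_pi_map fun i => aemeasurable_pi_lambda _ (hz i)]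
  simp_rw [hrow]
  have hall := h.map_fun_eq_pi_map fun p : ι × κ => hz p.1 p.2
  -- Currying carries the product measure over pairs to the product of the row laws; on finite index
  -- types `infinitePi` is `pi`.
  have hcurry := Measure.infinitePi_map_curry (fun i j => P.map (z i j))
  simp_rw [Measure.infinitePi_eq_pi] at hcurry
  rw [← hcurry, ← hall, AEMeasurable.map_map_of_aemeasurable (by fun_prop)
    (aemeasurable_pi_lambda _ fun p : ι × κ => hz p.1 p.2)]
  rfl

theorem ae_rademacher : ∀ᵐ t ∂rademacher, t = 1 ∨ t = -1 := by
  rw [rademacher, ae_add_measure_iff]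
  constructor <;> refine Measure.ae_smul_measure ?_ _ <;> rw [ae_dirac_eq] <;> simp

theorem integral_id_rademacher : ∫ t, t ∂rademacher = 0 := by
  have hi : ∀ a : ℝ, Integrable (fun t : ℝ => t) ((2⁻¹ : ENNReal) • Measure.dirac a) := fun a =>
    (integrable_dirac (by simp)).smul_measure (by simp)
  rw [rademacher, integral_add_measure (hi 1) (hi (-1)), integral_smul_measure,
    integral_smul_measure, integral_dirac, integral_dirac]
  simp

theorem ae_eq_one_or_neg_one {Ω : Type*} [MeasurableSpace Ω] {P : Measure Ω} {X : Ω → ℝ}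
    (hX : HasLaw X rademacher P) :
    ∀ᵐ ω ∂P, X ω = 1 ∨ X ω = -1 := by
  have h := ae_rademacher
  rw [← hX.map_eq] at h
  exact ae_of_ae_map hX.aemeasurable h

theorem integral_mul_rademacher {n : ℕ} {Z : Fin n → Ω → ℝ}
    (hlaw : ∀ j, HasLaw (Z j) rademacher P) (hindep : iIndepFun Z P) (j l : Fin n) :
    ∫ ω, Z j ω * Z l ω ∂P = if j = l then 1 else 0 := by
  split_ifs with hjl
  · subst hjl
    have : (fun ω => Z j ω * Z j ω) =ᵐ[P] fun _ => 1 := by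
      filter_upwards [ae_eq_one_or_neg_one (hlaw j)] with ω hω
      rcases hω with h | h <;> simp [h]
    rw [integral_congr_ae this]
    simp
  · rw [(hindep.indepFun hjl).integral_fun_mul_eq_mul_integral
      (hlaw j).aemeasurable.aestronglyMeasurable (hlaw l).aemeasurable.aestronglyMeasurable,
      (hlaw j).integral_eq, integral_id_rademacher, zero_mul]

theorem integrable_mul_rademacher {X Y : Ω → ℝ} (hX : HasLaw X rademacher P)
    (hY : HasLaw Y rademacher P) : Integrable (fun ω => X ω * Y ω) P := by
  refine Integrable.of_mem_Icc (-1) 1 (hX.aemeasurable.mul hY.aemeasurable) ?_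
  filter_upwards [ae_eq_one_or_neg_one hX, ae_eq_one_or_neg_one hY] with ω h1 h2
  rcases h1 with h1 | h1 <;> rcases h2 with h2 | h2 <;> simp [h1, h2]

theorem inner_toLp_sq {n : ℕ} (u : EuclideanSpace ℝ (Fin n)) (y : Fin n → ℝ) :
    ⟪u, WithLp.toLp 2 y⟫ ^ 2 = ∑ j, ∑ l, u j * u l * (y j * y l) := by
  simp only [PiLp.inner_apply, RCLike.inner_apply, conj_trivial, sq, Finset.sum_mul_sum]
  exact Finset.sum_congr rfl fun j _ => Finset.sum_congr rfl fun l _ => by ring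

theorem integrable_inner_sq {n : ℕ} {Z : Fin n → Ω → ℝ}
    (hlaw : ∀ j, HasLaw (Z j) rademacher P) (u : EuclideanSpace ℝ (Fin n)) :
    Integrable (fun ω => ⟪u, WithLp.toLp 2 fun j => Z j ω⟫ ^ 2) P := by
  simp_rw [inner_toLp_sq]
  exact integrable_finsetSum _ fun j _ => integrable_finsetSum _ fun l _ =>
    (integrable_mul_rademacher (hlaw j) (hlaw l)).const_mul _

theorem integral_inner_sq {n : ℕ} {Z : Fin n → Ω → ℝ}
    (hlaw : ∀ j, HasLaw (Z j) rademacher P) (hindep : iIndepFun Z P)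
    (u : EuclideanSpace ℝ (Fin n)) :
    ∫ ω, ⟪u, WithLp.toLp 2 fun j => Z j ω⟫ ^ 2 ∂P = ‖u‖ ^ 2 := by
  have hi : ∀ j l, Integrable (fun ω => u j * u l * (Z j ω * Z l ω)) P := fun j l =>
    (integrable_mul_rademacher (hlaw j) (hlaw l)).const_mul _
  simp_rw [inner_toLp_sq]
  rw [integral_finsetSum _ fun j _ => integrable_finsetSum _ fun l _ => hi j l]
  simp_rw [fun j => integral_finsetSum (Finset.univ (α := Fin n)) fun l _ => hi j l,
    integral_const_mul, integral_mul_rademacher hlaw hindep]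
  rw [EuclideanSpace.norm_sq_eq]
  simp [sq]

theorem norm_inv_sqrt_smul_toLp {n : ℕ} (hn : 0 < n) {y : Fin n → ℝ}
    (hy : ∀ j, y j = 1 ∨ y j = -1) : ‖(√(n : ℝ))⁻¹ • WithLp.toLp 2 y‖ = 1 := by
  have h : ‖WithLp.toLp 2 y‖ = √(n : ℝ) := by
    rw [EuclideanSpace.norm_eq]
    have : ∀ j, ‖y j‖ ^ 2 = 1 := fun j => by rcases hy j with h | h <;> simp [h]
    simp only [this, Finset.sum_const, Finset.card_univ, Fintype.card_fin, nsmul_eq_mul, mul_one]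
  have hn' : 0 < √(n : ℝ) := Real.sqrt_pos.mpr (by exact_mod_cast hn)
  rw [norm_smul, h, norm_inv, Real.norm_of_nonneg hn'.le, inv_mul_cancel₀ hn'.ne']

/-- Two-sided Hoeffding inequality for independent variables with values in an interval of
length `L`. -/
theorem measureReal_abs_sum_sub_ge_le {N : ℕ} {Y : Fin N → Ω → ℝ} (hY : ∀ i, AEMeasurable (Y i) P)
    (hindep : iIndepFun Y P) {a L μ : ℝ} (hb : ∀ i, ∀ᵐ ω ∂P, Y i ω ∈ Set.Icc a (a + L))
    (hμ : ∀ i, ∫ ω, Y i ω ∂P = μ) {t : ℝ} (ht : 0 ≤ t) :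
    P.real {ω | t ≤ |∑ i, (Y i ω - μ)|} ≤ 2 * Real.exp (-(2 * t ^ 2 / (N * L ^ 2))) := by
  have hs : ∀ i, HasSubgaussianMGF (fun ω => Y i ω - μ) ((‖a + L - a‖₊ / 2) ^ 2) P := fun i => by
    rw [← hμ i]
    exact hasSubgaussianMGF_of_mem_Icc (hY i) (hb i)
  have hi : iIndepFun (fun i ω => Y i ω - μ) P :=
    hindep.comp (fun _ y => y - μ) fun _ => by fun_prop
  have hi' : iIndepFun (fun i ω => -(Y i ω - μ)) P :=
    hindep.comp (fun _ y => -(y - μ)) fun _ => by fun_prop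
  have h1 := HasSubgaussianMGF.measure_sum_ge_le_of_iIndepFun hi (s := Finset.univ)
    (fun i _ => hs i) ht
  have h2 := HasSubgaussianMGF.measure_sum_ge_le_of_iIndepFun hi' (s := Finset.univ)
    (fun i _ => (hs i).neg) ht
  have he : -t ^ 2 / (2 * ((∑ _i : Fin N, (‖a + L - a‖₊ / 2) ^ 2 : NNReal) : ℝ))
      = -(2 * t ^ 2 / (N * L ^ 2)) := by
    simp only [add_sub_cancel_left, Finset.sum_const, Finset.card_univ, Fintype.card_fin,
      nsmul_eq_mul, NNReal.coe_mul, NNReal.coe_natCast, NNReal.coe_pow, NNReal.coe_div,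
      coe_nnnorm, Real.norm_eq_abs, NNReal.coe_ofNat, div_pow, sq_abs]
    rw [← neg_div, show 2 * ((N : ℝ) * (L ^ 2 / 2 ^ 2)) = N * L ^ 2 / 2 by ring,
      div_div_eq_mul_div]
    ring
  rw [he] at h1 h2
  calc _ ≤ P.real ({ω | t ≤ ∑ i, (Y i ω - μ)} ∪ {ω | t ≤ ∑ i, -(Y i ω - μ)}) := by
        refine measureReal_mono fun ω hω => ?_
        simp only [Set.mem_union, Set.mem_ofPred_eq, Finset.sum_neg_distrib] at hω ⊢
        exact le_abs.mp hω
    _ ≤ _ := measureReal_union_le _ _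
    _ ≤ _ := by linarith

end Probability

/-! ### The quadratic form of `log A` and its mean. -/

section QuadraticForm

variable {n : ℕ} {A : Matrix (Fin n) (Fin n) ℝ}

/-- The quadratic form `xᵀ log(A) x` of the matrix logarithm. -/
def logForm (hA : A.IsHermitian) (x : EuclideanSpace ℝ (Fin n)) : ℝ :=
  ∑ k, ⟪hA.eigenvectorBasis k, x⟫ ^ 2 * Real.log (hA.eigenvalues k)

theorem continuous_logForm (hA : A.IsHermitian) : Continuous (logForm hA) := by
  unfold logForm
  fun_prop

theorem logForm_mem_Icc (hA : A.IsHermitian) {a b : ℝ} (ha : 0 < a)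
    (hspec : ∀ k, hA.eigenvalues k ∈ Set.Icc a b) {x : EuclideanSpace ℝ (Fin n)} (hx : ‖x‖ = 1) :
    logForm hA x ∈ Set.Icc (Real.log a) (Real.log b) := by
  have h2 := sum_sq_inner_eigenvectorBasis hA x
  rw [hx, one_pow] at h2
  unfold logForm
  constructor
  · calc _ = ∑ k, ⟪hA.eigenvectorBasis k, x⟫ ^ 2 * Real.log a := by
          rw [← Finset.sum_mul, h2, one_mul]
      _ ≤ _ := Finset.sum_le_sum fun k _ => mul_le_mul_of_nonneg_left
          (Real.log_le_log ha (hspec k).1) (sq_nonneg _)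
  · calc _ ≤ ∑ k, ⟪hA.eigenvectorBasis k, x⟫ ^ 2 * Real.log b :=
          Finset.sum_le_sum fun k _ => mul_le_mul_of_nonneg_left
            (Real.log_le_log (ha.trans_le (hspec k).1) (hspec k).2) (sq_nonneg _)
      _ = _ := by rw [← Finset.sum_mul, h2, one_mul]

theorem log_det_eq_sum (hA : A.PosDef) :
    Real.log A.det = ∑ k, Real.log (hA.1.eigenvalues k) := by
  rw [hA.1.det_eq_prod_eigenvalues]
  exact Real.log_prod fun k _ => (hA.eigenvalues_pos k).ne'

variable {Ω : Type*} [MeasurableSpace Ω] {P : Measure Ω} [IsProbabilityMeasure P]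

/-- Hutchinson's trace estimator is unbiased. -/
theorem integral_logForm (hA : A.PosDef) {Z : Fin n → Ω → ℝ}
    (hlaw : ∀ j, HasLaw (Z j) rademacher P) (hindep : iIndepFun Z P) :
    ∫ ω, logForm hA.1 ((√(n : ℝ))⁻¹ • WithLp.toLp 2 fun j => Z j ω) ∂P
      = Real.log A.det / n := by
  simp only [logForm, inner_smul_right, mul_pow]
  rw [integral_finsetSum _ fun k _ =>
    ((integrable_inner_sq hlaw (hA.1.eigenvectorBasis k)).const_mul _).mul_const _]
  simp_rw [integral_mul_const, integral_const_mul, integral_inner_sq hlaw hindep]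
  rw [log_det_eq_sum hA, Finset.sum_div]
  refine Finset.sum_congr rfl fun k _ => ?_
  rw [hA.1.eigenvectorBasis.norm_eq_one, inv_pow, Real.sq_sqrt (Nat.cast_nonneg n)]
  ring

end QuadraticForm

/-! ### Sample size and assembly of the two errors. -/

theorem two_mul_exp_neg_le {ε η L N : ℝ} (hε : 0 < ε) (hη : η ∈ Set.Ioo (0 : ℝ) 1) (hL : 0 < L)
    (hN : 24 / ε ^ 2 * L ^ 2 * Real.log (2 / η) ≤ N) :
    2 * Real.exp (-(2 * (N * ε / 2) ^ 2 / (N * L ^ 2))) ≤ η := by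
  have hη0 := hη.1
  have hlog : 0 < Real.log (2 / η) := Real.log_pos (by rw [lt_div_iff₀ hη0]; linarith [hη.2])
  have hN0 : 0 < N := lt_of_lt_of_le (by positivity) hN
  have h1 : 24 * L ^ 2 * Real.log (2 / η) ≤ N * ε ^ 2 := by
    have := mul_le_mul_of_nonneg_right hN (sq_nonneg ε)
    calc _ = 24 / ε ^ 2 * L ^ 2 * Real.log (2 / η) * ε ^ 2 := by field_simp
      _ ≤ _ := this
  have h2 : Real.log (2 / η) ≤ 2 * (N * ε / 2) ^ 2 / (N * L ^ 2) := by
    rw [le_div_iff₀ (by positivity)]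
    have h3 : 0 ≤ L ^ 2 * Real.log (2 / η) := by positivity
    -- The constant 2 in place of 24 would already suffice here.
    have h4 : L ^ 2 * Real.log (2 / η) ≤ N * ε ^ 2 / 2 := by linarith
    calc _ = N * (L ^ 2 * Real.log (2 / η)) := by ring
      _ ≤ N * (N * ε ^ 2 / 2) := mul_le_mul_of_nonneg_left h4 hN0.le
      _ = _ := by ring
  calc _ ≤ 2 * Real.exp (-Real.log (2 / η)) := by
        gcongr
    _ = η := by
        rw [Real.exp_neg, Real.exp_log (by positivity)]
        field_simp

/-- Deterministic bound for the estimator in terms of the deviation of the quadratic forms and the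
quadrature errors. -/
theorem abs_log_det_sub_logDetEstimate_le {n N m : ℕ} {A : Matrix (Fin n) (Fin n) ℝ}
    (hA : A.IsHermitian) (hn : 0 < n) (hN : 0 < N) {ε : ℝ} {y : Fin N → Fin n → ℝ}
    (hdev : |∑ i, (logForm hA ((√(n : ℝ))⁻¹ • WithLp.toLp 2 (y i)) - Real.log A.det / n)|
      ≤ N * ε / 2)
    (hquad : ∀ i, |logForm hA ((√(n : ℝ))⁻¹ • WithLp.toLp 2 (y i))
      - lanczosQuadrature A ((√(n : ℝ))⁻¹ • WithLp.toLp 2 (y i)) m| ≤ ε / 2) :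
    |Real.log A.det - logDetEstimate A m N y| ≤ ε * n := by
  have hn' : (0 : ℝ) < n := by exact_mod_cast hn
  have hN' : (0 : ℝ) < N := by exact_mod_cast hN
  have hsum : |∑ i, (logForm hA ((√(n : ℝ))⁻¹ • WithLp.toLp 2 (y i))
      - lanczosQuadrature A ((√(n : ℝ))⁻¹ • WithLp.toLp 2 (y i)) m)| ≤ N * (ε / 2) := by
    refine (Finset.abs_sum_le_sum_abs _ _).trans ((Finset.sum_le_sum fun i _ => hquad i).trans ?_)
    simp
  have heq : Real.log A.det - logDetEstimate A m N y
      = n / N * (∑ i, (logForm hA ((√(n : ℝ))⁻¹ • WithLp.toLp 2 (y i))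
          - lanczosQuadrature A ((√(n : ℝ))⁻¹ • WithLp.toLp 2 (y i)) m)
        - ∑ i, (logForm hA ((√(n : ℝ))⁻¹ • WithLp.toLp 2 (y i)) - Real.log A.det / n)) := by
    rw [logDetEstimate, Finset.sum_sub_distrib, Finset.sum_sub_distrib, Finset.sum_const,
      Finset.card_univ, Fintype.card_fin, nsmul_eq_mul]
    field_simp
    ring
  rw [heq, abs_mul, abs_of_pos (by positivity)]
  calc _ ≤ (n : ℝ) / N * (N * (ε / 2) + N * ε / 2) := by
        gcongr
        exact (abs_sub _ _).trans (add_le_add hsum hdev)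
    _ = _ := by field_simp; ring

end SLQ

end

theorem theorem3p8 {n : ℕ} (A : Matrix (Fin n) (Fin n) ℝ) (hA : A.PosDef)
    (lmin lmax κ : ℝ) (hmin : IsLeast (spectrum ℝ A) lmin) (hmax : IsGreatest (spectrum ℝ A) lmax)
    (hκ : κ = lmax / lmin)
    (ε η : ℝ) (hε : ε ∈ Set.Ioo (0 : ℝ) 1) (hη : η ∈ Set.Ioo (0 : ℝ) 1)
    (m N : ℕ)
    (hm : 1 / (2 * Real.log (SLQ.rho κ)) * Real.log (SLQ.boundK κ / ε) ≤ (m : ℝ))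
    (hN : 24 / ε ^ 2 * Real.log (1 + κ) ^ 2 * Real.log (2 / η) ≤ (N : ℝ))
    {Ω : Type*} [MeasurableSpace Ω] (P : Measure Ω) [IsProbabilityMeasure P]
    (z : Fin N → Fin n → Ω → ℝ)
    (hlaw : ∀ i j, HasLaw (z i j) SLQ.rademacher P)
    (hindep : iIndepFun (fun p : Fin N × Fin n => z p.1 p.2) P) :
    1 - η ≤ P.real {ω | |Real.log A.det - SLQ.logDetEstimate A m N (fun i j => z i j ω)|
      ≤ ε * n} := by
  have hspec : ∀ k, hA.1.eigenvalues k ∈ Set.Icc lmin lmax := fun k =>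
    ⟨hmin.2 (hA.1.eigenvalues_mem_spectrum_real k), hmax.2 (hA.1.eigenvalues_mem_spectrum_real k)⟩
  obtain ⟨k₀, hk₀⟩ : lmin ∈ Set.range hA.1.eigenvalues :=
    hA.1.spectrum_real_eq_range_eigenvalues ▸ hmin.1
  -- An attained least eigenvalue rules out the empty matrix.
  have hn : 0 < n := k₀.pos
  have hl : 0 < lmin := hk₀ ▸ hA.eigenvalues_pos k₀
  have hle : lmin ≤ lmax := hmin.2 hmax.1
  have hκ1 : 1 ≤ κ := hκ ▸ (one_le_div hl).mpr hle
  have hL : 0 < Real.log (1 + κ) := Real.log_pos (by linarith)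
  have hε0 := hε.1
  have hN0 : 0 < N := by
    have hlog : 0 < Real.log (2 / η) :=
      Real.log_pos (by rw [lt_div_iff₀ hη.1]; linarith [hη.2])
    have : (0 : ℝ) < N := lt_of_lt_of_le (by positivity) hN
    exact_mod_cast this
  set Y : Fin N → Ω → ℝ := fun i ω =>
    SLQ.logForm hA.1 ((√(n : ℝ))⁻¹ • WithLp.toLp 2 fun j => z i j ω) with hY_def
  have hg : Measurable fun y : Fin n → ℝ =>
      SLQ.logForm hA.1 ((√(n : ℝ))⁻¹ • WithLp.toLp 2 y) := by
    refine Continuous.measurable ?_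
    exact (SLQ.continuous_logForm hA.1).comp (by fun_prop)
  have hz : ∀ i j, AEMeasurable (z i j) P := fun i j => (hlaw i j).aemeasurable
  have hY : ∀ i, AEMeasurable (Y i) P := fun i =>
    hg.comp_aemeasurable (aemeasurable_pi_lambda _ (hz i))
  have hYindep : iIndepFun Y P := (SLQ.iIndepFun_rows hz hindep).comp _ fun _ => hg
  have hsign : ∀ᵐ ω ∂P, ∀ i j, z i j ω = 1 ∨ z i j ω = -1 :=
    ae_all_iff.mpr fun i => ae_all_iff.mpr fun j => SLQ.ae_eq_one_or_neg_one (hlaw i j)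
  have hYb : ∀ i, ∀ᵐ ω ∂P,
      Y i ω ∈ Set.Icc (Real.log lmin) (Real.log lmin + Real.log (1 + κ)) := fun i => by
    filter_upwards [hsign] with ω hω
    have h := SLQ.logForm_mem_Icc hA.1 hl hspec (SLQ.norm_inv_sqrt_smul_toLp hn (hω i))
    refine ⟨h.1, h.2.trans ?_⟩
    -- Enlarging `log κ` to `log (1 + κ)` keeps the interval length positive even when `κ = 1`.
    rw [← Real.log_mul hl.ne' (by linarith)]
    refine Real.log_le_log (hl.trans_le hle) ?_
    have : lmin * κ = lmax := by rw [hκ, mul_div_cancel₀ _ hl.ne']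
    linarith
  have hYμ : ∀ i, ∫ ω, Y i ω ∂P = Real.log A.det / n := fun i =>
    SLQ.integral_logForm hA (hlaw i)
      (hindep.precomp (g := fun j : Fin n => (i, j)) fun _ _ h => (Prod.ext_iff.mp h).2)
  have hdev := (SLQ.measureReal_abs_sum_sub_ge_le hY hYindep hYb hYμ
    (t := N * ε / 2) (by positivity)).trans (SLQ.two_mul_exp_neg_le hε0 hη hL hN)
  have hnull : P.real {ω | ¬ ∀ i j, z i j ω = 1 ∨ z i j ω = -1} = 0 := by
    rw [measureReal_def, ae_iff.mp hsign, ENNReal.toReal_zero]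
  set G := {ω | |Real.log A.det - SLQ.logDetEstimate A m N (fun i j => z i j ω)| ≤ ε * n}
  -- Covering the whole space and using subadditivity bounds `P.real G` from below without
  -- measurability of `G`, hence of the Lanczos estimate.
  have hcover : (Set.univ : Set Ω) ⊆ G ∪ ({ω | N * ε / 2 ≤ |∑ i, (Y i ω - Real.log A.det / n)|} ∪
      {ω | ¬ ∀ i j, z i j ω = 1 ∨ z i j ω = -1}) := by
    intro ω _
    by_cases h1 : ∀ i j, z i j ω = 1 ∨ z i j ω = -1
    · rcases le_total (N * ε / 2) |∑ i, (Y i ω - Real.log A.det / n)| with h2 | h2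
      · exact Or.inr (Or.inl h2)
      · refine Or.inl (SLQ.abs_log_det_sub_logDetEstimate_le hA.1 hn hN0 h2 fun i => ?_)
        exact SLQ.abs_sub_lanczosQuadrature_le_half hA.1 (SLQ.norm_inv_sqrt_smul_toLp hn (h1 i))
          hl hle hspec hε0 (hκ ▸ hm)
    · exact Or.inr (Or.inr h1)
  have h1 := measureReal_mono (μ := P) hcover
  rw [probReal_univ] at h1
  have h2 := measureReal_union_le (μ := P) G
    ({ω | N * ε / 2 ≤ |∑ i, (Y i ω - Real.log A.det / n)|} ∪
      {ω | ¬ ∀ i j, z i j ω = 1 ∨ z i j ω = -1})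
  have h3 := measureReal_union_le (μ := P) {ω | N * ε / 2 ≤ |∑ i, (Y i ω - Real.log A.det / n)|}
      {ω | ¬ ∀ i j, z i j ω = 1 ∨ z i j ω = -1}
  linarith
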